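/- Let $\phi:\mathbb{R}^2,0\to\mathbb{R}^3,0$ be a geometric cross-cap, i.e. the germ of $$\phi(x,y)=\bigl(x,\;xy+p(y),\;ax^2+bxy+y^2+q(x,y)\bigr),$$ where $a,b\in\mathbb{R}$ and $p$, $q$ are germs of smooth functions with $p(y)=O(|y|^3)$ and $q(x,y)=O(\|(x,y)\|^3)$ at the origin. For $\eta$ in the unit sphere $S^2\subset\mathbb{R}^3$ and $\delta\in\mathbb{R}$, let $$f_{(\eta,\delta)}=\phi+(\langle\eta,\phi\rangle-\delta)(\langle\eta,\phi\rangle-\delta-1)\,\eta$$ be the folding map with respect to the plane $\langle\,\cdot\,,\eta\rangle=\delta$, and write $f_\eta=f_{(\eta,0)}$. An unfolding of a germ $f:\mathbb{R}^n,0\to\mathbb{R}^p,0$ with $r$ parameters is a smooth map-germ $G(x,u)=(\bar g(x,u),u)$ at $(0,0)\in\mathbb{R}^n\times\mathbb{R}^r$, with $G(0,0)=(0,0)$ and $\bar g(x,0)=f(x)$. An unfolding $F(x,u)=(\bar f(x,u),u)$ of $f$ is $\mathcal{A}_e$-versal if every unfolding $G$ of $f$, with any number $r$ of parameters, is induced from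 it: there are a smooth germ $\psi:\mathbb{R}^r,0\to\mathbb{R}^q,0$ and smooth families of germs of diffeomorphisms $h_v$ of $\mathbb{R}^n$ and $k_v$ of $\mathbb{R}^p$, $v\in\mathbb{R}^r$ near $0$, with $h_0=\mathrm{id}$ and $k_0=\mathrm{id}$ (not required to fix the origin for $v\ne0$), such that $\bar g_v\circ h_v=k_v\circ\bar f_{\psi(v)}$ near the origin. Let $\eta_0\in S^2$ be arbitrary. For $\xi=(u,v,w)\in\mathbb{R}^3$ near $0$ put $\bar\eta=(\eta_0+\xi)/\|\eta_0+\xi\|$. Then $$F(x,y,u,v,w,\delta)=\bigl(f_{(\bar\eta,\delta)}(x,y),u,v,w,\delta\bigr)$$ is a 4-parameter unfolding of $f_{\eta_0}$, and it is not $\mathcal{A}_e$-versal. Moreover, if $\dot F_u,\dot F_v,\dot F_w,\dot F_\delta$ are its initial speeds (the derivatives of $f_{(\bar\eta,\delta)}$ with respect to $u,v,w,\delta$ at $(u,v,w,\delta)=0$), if $\mathcal{E}_n$ denotes the ring of germs at $0$ of smooth functions on $\mathbb{R}^n$ and $\mathcal{E}(2,3)=(\mathcal{E}_2)^3$, and if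 $$T_e\mathcal{A}\cdot f_{\eta_0}=\mathcal{E}_2\cdot\Bigl\{\tfrac{\partial f_{\eta_0}}{\partial x},\tfrac{\partial f_{\eta_0}}{\partial y}\Bigr\}+f_{\eta_0}^*(\mathcal{E}_3)\cdot\{e_1,e_2,e_3\},$$ then $$T_e\mathcal{A}\cdot f_{\eta_0}+\mathbb{R}\cdot\{\dot F_u,\dot F_v,\dot F_w,\dot F_\delta\}\neq\mathcal{E}(2,3).$$ (In particular $T_e\mathcal{A}\cdot f_{\eta_0}\ne\mathcal{E}(2,3)$, i.e. $f_{\eta_0}$ is not infinitesimally stable.) -/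

import Mathlib

open scoped Topology ContDiff
open Asymptotics

/-- The space `ℝⁿ` with its Euclidean structure. -/
abbrev Euc (n : ℕ) : Type := EuclideanSpace ℝ (Fin n)

/-- `f` represents a germ of smooth map at `x₀`: it is `C^∞` on a neighbourhood of `x₀`. -/
def SmoothNear {V W : Type*} [NormedAddCommGroup V] [NormedSpace ℝ V]
    [NormedAddCommGroup W] [NormedSpace ℝ W] (f : V → W) (x₀ : V) : Prop :=
  ∀ᶠ x in 𝓝 x₀, ContDiffAt ℝ ∞ f x

/-! ### Unfoldings, induced unfoldings, versality -/

/-- `F` represents a `q`-parameter unfolding of the germ at `0` of `f : ℝⁿ, 0 → ℝᵖ, 0`: a smooth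
map-germ `ℝⁿ × ℝ^q, (0, 0) → ℝᵖ × ℝ^q, (0, 0)` of the form `F (x, u) = (f̄ (x, u), u)` with
`f̄ (x, 0) = f x`. -/
structure IsUnfolding {n p q : ℕ} (F : Euc n × Euc q → Euc p × Euc q) (f : Euc n → Euc p) :
    Prop where
  smooth : SmoothNear F 0
  map_zero : F 0 = 0
  snd_eq : ∀ᶠ z in 𝓝 (0 : Euc n × Euc q), (F z).2 = z.2
  restrict : ∀ᶠ x in 𝓝 (0 : Euc n), (F (x, 0)).1 = f x

/-- The unfolding `(r, G)` is induced from the unfolding `(q, F)`: there are a smooth parameter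
germ `ψ : ℝʳ, 0 → ℝ^q, 0` and smooth families of germs of diffeomorphisms `h_v = h (·, v)` of the
source and `k_v = k (·, v)` of the target, with `h₀ = id` and `k₀ = id`, such that
`ḡ_v ∘ h_v = k_v ∘ f̄_{ψ v}`, that is, `ḡ_v = k_v ∘ f̄_{ψ v} ∘ h_v⁻¹`.
(That `h_v` and `k_v` are local diffeomorphisms for small `v` is automatic from `h₀ = id` and
`k₀ = id`. As usual for the extended group, they may move the origin when `v ≠ 0`.) -/
def IsInducedFrom {n p q r : ℕ} (G : Euc n × Euc r → Euc p × Euc r)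
    (F : Euc n × Euc q → Euc p × Euc q) : Prop :=
  ∃ (h : Euc n × Euc r → Euc n) (k : Euc p × Euc r → Euc p) (ψ : Euc r → Euc q),
    SmoothNear h 0 ∧ SmoothNear k 0 ∧ SmoothNear ψ 0 ∧
    (∀ᶠ x in 𝓝 (0 : Euc n), h (x, 0) = x) ∧
    (∀ᶠ y in 𝓝 (0 : Euc p), k (y, 0) = y) ∧
    ψ 0 = 0 ∧
    ∀ᶠ z in 𝓝 (0 : Euc n × Euc r), (G (h z, z.2)).1 = k ((F (z.1, ψ z.2)).1, z.2)

/-- `F` is an `𝒜ₑ`-versal unfolding of `f`: every unfolding of `f`, with any number of parameters,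
can be induced from `F`. -/
def IsAeVersal {n p q : ℕ} (F : Euc n × Euc q → Euc p × Euc q) (f : Euc n → Euc p) : Prop :=
  IsUnfolding F f ∧
    ∀ (r : ℕ) (G : Euc n × Euc r → Euc p × Euc r), IsUnfolding G f → IsInducedFrom G F

/-! ### The extended tangent space and the initial speeds -/

/-- `ℰ(n, p)`: the space of germs at `0` of smooth maps `ℝⁿ → ℝᵖ`. -/
def smoothGerms (n p : ℕ) : Submodule ℝ (Filter.Germ (𝓝 (0 : Euc n)) (Euc p)) where
  carrier := {γ | ∃ g : Euc n → Euc p, SmoothNear g 0 ∧ γ = Filter.Germ.ofFun g}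
  zero_mem' := ⟨fun _ => 0, Filter.Eventually.of_forall fun _ => contDiffAt_const, rfl⟩
  add_mem' := by
    rintro _ _ ⟨g₁, h₁, rfl⟩ ⟨g₂, h₂, rfl⟩
    exact ⟨fun x => g₁ x + g₂ x, (h₁.and h₂).mono fun x h => h.1.add h.2, rfl⟩
  smul_mem' := by
    rintro c _ ⟨g, h, rfl⟩
    exact ⟨fun x => c • g x, h.mono fun x hx => hx.const_smul c, rfl⟩

/-- The extended tangent space
`Tₑ𝒜·f = ℰ_n·{∂f/∂x₁, …, ∂f/∂x_n} + f^*(ℰ_p)·{e₁, …, e_p}`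
of a germ `f : ℝⁿ, 0 → ℝᵖ, 0`: the germs of `x ↦ ∑ i, ξ_i(x) ∂f/∂x_i(x) + κ (f x)`, where `ξ` and
`κ` are germs at `0` of smooth vector fields on the source and on the target. -/
def extTangentSpace {n p : ℕ} (f : Euc n → Euc p) :
    Submodule ℝ (Filter.Germ (𝓝 (0 : Euc n)) (Euc p)) where
  carrier := {γ | ∃ (ξ : Euc n → Euc n) (κ : Euc p → Euc p), SmoothNear ξ 0 ∧ SmoothNear κ 0 ∧
    γ = Filter.Germ.ofFun fun x => fderiv ℝ f x (ξ x) + κ (f x)}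
  zero_mem' := by
    refine ⟨fun _ => 0, fun _ => 0, Filter.Eventually.of_forall fun _ => contDiffAt_const,
      Filter.Eventually.of_forall fun _ => contDiffAt_const, ?_⟩
    simp only [map_zero, add_zero]
    rfl
  add_mem' := by
    rintro _ _ ⟨ξ₁, κ₁, hξ₁, hκ₁, rfl⟩ ⟨ξ₂, κ₂, hξ₂, hκ₂, rfl⟩
    refine ⟨fun x => ξ₁ x + ξ₂ x, fun y => κ₁ y + κ₂ y,
      (hξ₁.and hξ₂).mono fun x h => h.1.add h.2, (hκ₁.and hκ₂).mono fun x h => h.1.add h.2, ?_⟩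
    change Filter.Germ.ofFun
      (fun x => fderiv ℝ f x (ξ₁ x) + κ₁ (f x) + (fderiv ℝ f x (ξ₂ x) + κ₂ (f x))) = _
    congr 1
    funext x
    rw [map_add, add_add_add_comm]
  smul_mem' := by
    rintro c _ ⟨ξ, κ, hξ, hκ, rfl⟩
    refine ⟨fun x => c • ξ x, fun y => c • κ y, hξ.mono fun x h => h.const_smul c,
      hκ.mono fun x h => h.const_smul c, ?_⟩
    change Filter.Germ.ofFun (fun x => c • (fderiv ℝ f x (ξ x) + κ (f x))) = _
    simp only [map_smul, smul_add]

/-- The `i`-th initial speed `x ↦ ∂f̄/∂u_i (x, 0)` of an unfolding `F (x, u) = (f̄ (x, u), u)`. -/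
noncomputable def initialSpeed {n p q : ℕ} (F : Euc n × Euc q → Euc p × Euc q) (i : Fin q) :
    Euc n → Euc p :=
  fun x => fderiv ℝ (fun u : Euc q => (F (x, u)).1) 0 (EuclideanSpace.single i 1)

/-- The subspace `Tₑ𝒜·f + ℝ·{Ḟ₁, …, Ḟ_q}`. -/
noncomputable def extTangentSpaceAddSpeeds {n p q : ℕ} (F : Euc n × Euc q → Euc p × Euc q)
    (f : Euc n → Euc p) : Submodule ℝ (Filter.Germ (𝓝 (0 : Euc n)) (Euc p)) :=
  extTangentSpace f ⊔ Submodule.span ℝ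
    (Set.range fun i : Fin q => Filter.Germ.ofFun (initialSpeed F i))

/-! ### The cross-cap and its folding maps -/

/-- The parametrization `(x, y) ↦ (x, xy + p(y), ax² + bxy + y² + q(x, y))`. -/
noncomputable def crossCap (a b : ℝ) (p : ℝ → ℝ) (q : Euc 2 → ℝ) (z : Euc 2) : Euc 3 :=
  !₂[z 0, z 0 * z 1 + p (z 1), a * z 0 ^ 2 + b * z 0 * z 1 + z 1 ^ 2 + q z]

/-- The folding map `f_{(η, δ)} = φ + (⟨η, φ⟩ - δ)(⟨η, φ⟩ - δ - 1) η` with respect to the plane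
`⟨·, η⟩ = δ`, along the parametrized surface `φ`. -/
noncomputable def foldingMap (φ : Euc 2 → Euc 3) (η : Euc 3) (δ : ℝ) (z : Euc 2) : Euc 3 :=
  φ z + ((inner ℝ η (φ z) - δ) * (inner ℝ η (φ z) - δ - 1)) • η

/-- The unit vector `(η₀ + (u, v, w)) / ‖η₀ + (u, v, w)‖`, where `s = (u, v, w, δ)`. -/
noncomputable def perturbedNormal (η₀ : Euc 3) (s : Euc 4) : Euc 3 :=
  ‖η₀ + !₂[s 0, s 1, s 2]‖⁻¹ • (η₀ + !₂[s 0, s 1, s 2])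

/-- The family of folding maps near `(η₀, 0)`, as an unfolding with the four parameters
`s = (u, v, w, δ)`. -/
noncomputable def foldingUnfolding (φ : Euc 2 → Euc 3) (η₀ : Euc 3) (z : Euc 2 × Euc 4) :
    Euc 3 × Euc 4 :=
  (foldingMap φ (perturbedNormal η₀ z.2) (z.2 3) z.1, z.2)

/-! Write `f` for the folding map of `φ` with unit normal `η` and `δ = 0`. Two facts obstruct
versality. First, every folding map factors through `φ`, so all of them, whatever the plane, are
singular along the same direction `e` in the kernel of `dφ₀`; for the cross-cap `e = ∂/∂y`. Second,
`⟨η, f⟩ = ⟨η, φ⟩²`.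

Consider the functional `g ↦ ⟨η, dg₀(e)⟩`. It kills `κ ∘ f` because `df₀(e) = 0`. It kills `df(ξ)`
because `⟨η, df(ξ)⟩ = 2⟨η, φ⟩⟨η, dφ(ξ)⟩`, where `⟨η, φ⟩` vanishes at `0` together with its
derivative along `e`. It kills the initial speeds because they too factor through `φ`. It does not
kill `⟨e, ·⟩ η`, so the sum is not all of `ℰ(2, 3)`.

The failure of versality is proved directly from the definition: the unfolding `f + v⟨e, ·⟩ η`
cannot be induced, by a first-order comparison in `v` (`not_isInducedFrom_foldingUnfolding`). -/

/-- The folding map of the ambient space with respect to the plane `⟨·, η⟩ = δ`. -/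
noncomputable def ambientFold (η : Euc 3) (δ : ℝ) (y : Euc 3) : Euc 3 :=
  y + ((inner ℝ η y - δ) * (inner ℝ η y - δ - 1)) • η

theorem foldingMap_eq_comp (φ : Euc 2 → Euc 3) (η : Euc 3) (δ : ℝ) :
    foldingMap φ η δ = ambientFold η δ ∘ φ := rfl

theorem contDiff_ambientFold_uncurried :
    ContDiff ℝ ∞ fun w : Euc 3 × ℝ × Euc 3 => ambientFold w.1 w.2.1 w.2.2 := by
  unfold ambientFold
  have h : ContDiff ℝ ∞ fun w : Euc 3 × ℝ × Euc 3 => (inner ℝ w.1 w.2.2 : ℝ) :=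
    contDiff_fst.inner ℝ contDiff_snd.snd
  fun_prop

theorem contDiff_ambientFold (η : Euc 3) (δ : ℝ) : ContDiff ℝ ∞ (ambientFold η δ) :=
  contDiff_ambientFold_uncurried.comp
    (contDiff_const.prodMk (contDiff_const.prodMk contDiff_id) :
      ContDiff ℝ ∞ fun y : Euc 3 => (η, δ, y))

/-- With `t = ⟨η, φ⟩`, this is `t + t(t - 1) = t²`. -/
theorem inner_foldingMap_zero (φ : Euc 2 → Euc 3) {η : Euc 3} (hη : ‖η‖ = 1) (z : Euc 2) :
    (inner ℝ η (foldingMap φ η 0 z) : ℝ) = (inner ℝ η (φ z)) ^ 2 := by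
  simp only [foldingMap, inner_add_right, inner_smul_right, real_inner_self_eq_norm_sq, hη]
  ring

theorem SmoothNear.contDiffAt {V W : Type*} [NormedAddCommGroup V] [NormedSpace ℝ V]
    [NormedAddCommGroup W] [NormedSpace ℝ W] {f : V → W} {x : V} (h : SmoothNear f x) :
    ContDiffAt ℝ ∞ f x := Filter.Eventually.self_of_nhds h

theorem SmoothNear.foldingMap {φ : Euc 2 → Euc 3} (h : SmoothNear φ 0) (η : Euc 3) (δ : ℝ) :
    SmoothNear (foldingMap φ η δ) 0 :=
  h.mono fun _ hz => (contDiff_ambientFold η δ).contDiffAt.comp _ hz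

/-- Every folding map of a surface is singular in the directions in which the surface is. -/
theorem fderiv_foldingMap_eq_zero {φ : Euc 2 → Euc 3} (h : SmoothNear φ 0) {e : Euc 2}
    (he : fderiv ℝ φ 0 e = 0) (η : Euc 3) (δ : ℝ) : fderiv ℝ (foldingMap φ η δ) 0 e = 0 := by
  rw [foldingMap_eq_comp, fderiv_comp _ ((contDiff_ambientFold η δ).differentiable (by simp) _)
    (h.contDiffAt.differentiableAt (by simp))]
  simp [he]

theorem inner_fderiv_foldingMap_zero {φ : Euc 2 → Euc 3} {η : Euc 3} (hη : ‖η‖ = 1) {z : Euc 2}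
    (h : ContDiffAt ℝ ∞ φ z) (w : Euc 2) :
    (inner ℝ η (fderiv ℝ (foldingMap φ η 0) z w) : ℝ) =
      2 * inner ℝ η (φ z) * inner ℝ η (fderiv ℝ φ z w) := by
  have hd : DifferentiableAt ℝ φ z := h.differentiableAt (by simp)
  have hf : DifferentiableAt ℝ (foldingMap φ η 0) z :=
    ((contDiff_ambientFold η 0).contDiffAt.comp z h).differentiableAt (by simp)
  have h1 := ((innerSL ℝ η).hasFDerivAt (x := foldingMap φ η 0 z)).comp z hf.hasFDerivAt
  have h2 := (((innerSL ℝ η).hasFDerivAt (x := φ z)).comp z hd.hasFDerivAt).pow 2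
  have h3 : (innerSL ℝ η) ∘ foldingMap φ η 0 = fun x => ((innerSL ℝ η) ∘ φ) x ^ 2 :=
    funext fun x => inner_foldingMap_zero φ hη x
  rw [h3] at h1
  simpa using congrArg (fun L => L w) (h1.unique h2)

/-! ### Smoothness of the unfolding -/

theorem perturbedNormal_zero {η₀ : Euc 3} (hη₀ : ‖η₀‖ = 1) : perturbedNormal η₀ 0 = η₀ := by
  have h : (!₂[(0 : ℝ), 0, 0] : Euc 3) = 0 := by
    ext i; fin_cases i <;> rfl
  simp [perturbedNormal, h, hη₀]

theorem smoothNear_perturbedNormal {η₀ : Euc 3} (hη₀ : ‖η₀‖ = 1) :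
    SmoothNear (perturbedNormal η₀) 0 := by
  have hc : ContDiff ℝ ∞ fun s : Euc 4 => η₀ + (!₂[s 0, s 1, s 2] : Euc 3) := by
    refine contDiff_const.add (contDiff_euclidean.2 fun i => ?_)
    fin_cases i <;> simp <;> fun_prop
  -- If this vector vanished, its normalization would be `0`, whereas it is the unit vector `η₀`.
  have h0 : η₀ + (!₂[(0 : Euc 4) 0, (0 : Euc 4) 1, (0 : Euc 4) 2] : Euc 3) ≠ 0 := by
    intro h
    have h' := perturbedNormal_zero hη₀
    rw [perturbedNormal, h, smul_zero] at h'
    simp [← h'] at hη₀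
  filter_upwards [hc.continuous.continuousAt.eventually_ne h0] with s hs
  exact ((hc.contDiffAt.norm ℝ hs).inv (norm_ne_zero_iff.2 hs)).smul hc.contDiffAt

theorem smoothNear_foldingUnfolding {φ : Euc 2 → Euc 3} (h : SmoothNear φ 0) {η₀ : Euc 3}
    (hη₀ : ‖η₀‖ = 1) : SmoothNear (foldingUnfolding φ η₀) 0 := by
  have h1 : ∀ᶠ z : Euc 2 × Euc 4 in 𝓝 0, ContDiffAt ℝ ∞ φ z.1 :=
    (continuous_fst.tendsto (0 : Euc 2 × Euc 4)).eventually h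
  have h2 : ∀ᶠ z : Euc 2 × Euc 4 in 𝓝 0, ContDiffAt ℝ ∞ (perturbedNormal η₀) z.2 :=
    (continuous_snd.tendsto (0 : Euc 2 × Euc 4)).eventually (smoothNear_perturbedNormal hη₀)
  filter_upwards [h1, h2] with z hz1 hz2
  have h3 : ContDiffAt ℝ ∞ (fun z : Euc 2 × Euc 4 => z.2 3) z := by fun_prop
  refine ContDiffAt.prodMk ?_ contDiffAt_snd
  exact contDiff_ambientFold_uncurried.contDiffAt.comp z
    ((hz2.comp z contDiffAt_snd).prodMk (h3.prodMk (hz1.comp z contDiffAt_fst)))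

theorem isUnfolding_foldingUnfolding {φ : Euc 2 → Euc 3} (h : SmoothNear φ 0) (h0 : φ 0 = 0)
    {η₀ : Euc 3} (hη₀ : ‖η₀‖ = 1) :
    IsUnfolding (foldingUnfolding φ η₀) (foldingMap φ η₀ 0) where
  smooth := smoothNear_foldingUnfolding h hη₀
  map_zero := by simp [foldingUnfolding, foldingMap, h0]
  snd_eq := Filter.Eventually.of_forall fun _ => rfl
  restrict := Filter.Eventually.of_forall fun x => by
    simp [foldingUnfolding, perturbedNormal_zero hη₀]

/-! ### The obstruction -/

/-- The germs at `0` of differentiable maps whose derivative in the direction `e` is orthogonal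
to `η`. -/
def germsWithDerivOrthogonal (e : Euc 2) (η : Euc 3) :
    Submodule ℝ (Filter.Germ (𝓝 (0 : Euc 2)) (Euc 3)) where
  carrier := {γ | ∃ g : Euc 2 → Euc 3, DifferentiableAt ℝ g 0 ∧
    (inner ℝ η (fderiv ℝ g 0 e) : ℝ) = 0 ∧ γ = Filter.Germ.ofFun g}
  zero_mem' := ⟨fun _ => 0, differentiableAt_const _, by simp, rfl⟩
  add_mem' := by
    rintro _ _ ⟨g₁, h₁, o₁, rfl⟩ ⟨g₂, h₂, o₂, rfl⟩
    refine ⟨g₁ + g₂, h₁.add h₂, ?_, rfl⟩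
    rw [fderiv_add h₁ h₂, add_apply, inner_add_right, o₁, o₂, add_zero]
  smul_mem' := by
    rintro c _ ⟨g, h, o, rfl⟩
    refine ⟨c • g, h.const_smul c, ?_, rfl⟩
    rw [fderiv_const_smul h, smul_apply, inner_smul_right, o, mul_zero]

theorem ofFun_mem_germsWithDerivOrthogonal_iff {e : Euc 2} {η : Euc 3} {g : Euc 2 → Euc 3}
    (hg : DifferentiableAt ℝ g 0) :
    Filter.Germ.ofFun g ∈ germsWithDerivOrthogonal e η ↔
      (inner ℝ η (fderiv ℝ g 0 e) : ℝ) = 0 := by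
  refine ⟨?_, fun h => ⟨g, hg, h, rfl⟩⟩
  rintro ⟨g', -, h, hgg'⟩
  have : g =ᶠ[𝓝 0] g' := Filter.Germ.coe_eq.1 hgg'
  rwa [this.fderiv_eq]

theorem differentiableAt_fderiv_apply {f : Euc 2 → Euc 3} {ξ : Euc 2 → Euc 2}
    (hf : SmoothNear f 0) (hξ : SmoothNear ξ 0) :
    DifferentiableAt ℝ (fun x => fderiv ℝ f x (ξ x)) 0 :=
  ((hf.contDiffAt.fderiv_right (m := 1) (by norm_cast)).differentiableAt (by simp)).clm_apply
    (hξ.contDiffAt.differentiableAt (by simp))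

/-- The source and target vector fields are treated separately: the square `⟨η, φ⟩²` handles the
first, the chain rule with `df₀(e) = 0` the second. -/
theorem extTangentSpace_foldingMap_le {φ : Euc 2 → Euc 3} (h : SmoothNear φ 0) (h0 : φ 0 = 0)
    {e : Euc 2} (he : fderiv ℝ φ 0 e = 0) {η : Euc 3} (hη : ‖η‖ = 1) :
    extTangentSpace (foldingMap φ η 0) ≤ germsWithDerivOrthogonal e η := by
  rintro _ ⟨ξ, κ, hξ, hκ, rfl⟩
  have hf := h.foldingMap η 0
  have hf0 : foldingMap φ η 0 0 = 0 := by simp [foldingMap, h0]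
  have hφd : DifferentiableAt ℝ φ 0 := h.contDiffAt.differentiableAt (by simp)
  have hfd : DifferentiableAt ℝ (foldingMap φ η 0) 0 := hf.contDiffAt.differentiableAt (by simp)
  have hκd : DifferentiableAt ℝ κ (foldingMap φ η 0 0) := by
    rw [hf0]; exact hκ.contDiffAt.differentiableAt (by simp)
  have hd1 := differentiableAt_fderiv_apply hf hξ
  refine (germsWithDerivOrthogonal e η).add_mem
    (x := Filter.Germ.ofFun fun x => fderiv ℝ (foldingMap φ η 0) x (ξ x))
    (y := Filter.Germ.ofFun (κ ∘ foldingMap φ η 0)) ?_ ?_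
  · rw [ofFun_mem_germsWithDerivOrthogonal_iff hd1]
    have h1 := ((innerSL ℝ η).hasFDerivAt).comp 0 hd1.hasFDerivAt
    -- Product rule for `2⟨η, φ⟩⟨η, dφ(ξ)⟩`: one term carries the factor `φ 0 = 0`, the other
    -- `dφ₀(e) = 0`.
    have h2 := (((innerSL ℝ η).hasFDerivAt).comp 0 hφd.hasFDerivAt).const_mul 2 |>.mul
      (((innerSL ℝ η).hasFDerivAt).comp 0 (differentiableAt_fderiv_apply h hξ).hasFDerivAt)
    have h3 := h2.congr_of_eventuallyEq
      (h.mono fun z hz => inner_fderiv_foldingMap_zero hη hz (ξ z))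
    simpa [h0, he] using congrArg (fun L => L e) (h1.unique h3)
  · rw [ofFun_mem_germsWithDerivOrthogonal_iff (hκd.comp 0 hfd), fderiv_comp _ hκd hfd]
    simp [fderiv_foldingMap_eq_zero h he]

/-- The parameters move only the ambient fold, so each speed is `H ∘ φ` with `H` differentiable at
`φ 0`, and its derivative along `e` vanishes. -/
theorem initialSpeed_foldingUnfolding_mem {φ : Euc 2 → Euc 3} (h : SmoothNear φ 0)
    {e : Euc 2} (he : fderiv ℝ φ 0 e = 0) {η : Euc 3} (hη : ‖η‖ = 1) (i : Fin 4) :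
    Filter.Germ.ofFun (initialSpeed (foldingUnfolding φ η) i) ∈ germsWithDerivOrthogonal e η := by
  let H : Euc 3 → Euc 3 := fun y =>
    fderiv ℝ (fun u : Euc 4 => ambientFold (perturbedNormal η u) (u 3) y) 0
      (EuclideanSpace.single i 1)
  have hH : DifferentiableAt ℝ H (φ 0) := by
    have h3 : ContDiffAt ℝ ∞ (fun w : Euc 3 × Euc 4 => w.2 3) (φ 0, 0) := by fun_prop
    have hn : ContDiffAt ℝ ∞ (fun w : Euc 3 × Euc 4 => perturbedNormal η w.2) (φ 0, 0) :=
      ContDiffAt.comp (g := perturbedNormal η) (φ 0, (0 : Euc 4))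
        (smoothNear_perturbedNormal hη).contDiffAt contDiffAt_snd
    have hc : ContDiffAt ℝ ∞ (Function.uncurry fun (y : Euc 3) (u : Euc 4) =>
        ambientFold (perturbedNormal η u) (u 3) y) (φ 0, 0) :=
      contDiff_ambientFold_uncurried.contDiffAt.comp (φ 0, (0 : Euc 4))
        (hn.prodMk (h3.prodMk contDiffAt_fst))
    exact ((hc.fderiv (m := 1) contDiffAt_const (by norm_cast)).differentiableAt
      (by simp)).clm_apply (differentiableAt_const _)
  have hφd : DifferentiableAt ℝ φ 0 := h.contDiffAt.differentiableAt (by simp)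
  change Filter.Germ.ofFun (H ∘ φ) ∈ _
  rw [ofFun_mem_germsWithDerivOrthogonal_iff (hH.comp 0 hφd), fderiv_comp _ hH hφd]
  simp [he]

theorem extTangentSpaceAddSpeeds_foldingUnfolding_le {φ : Euc 2 → Euc 3} (h : SmoothNear φ 0)
    (h0 : φ 0 = 0) {e : Euc 2} (he : fderiv ℝ φ 0 e = 0) {η : Euc 3} (hη : ‖η‖ = 1) :
    extTangentSpaceAddSpeeds (foldingUnfolding φ η) (foldingMap φ η 0) ≤
      germsWithDerivOrthogonal e η :=
  sup_le (extTangentSpace_foldingMap_le h h0 he hη) <| Submodule.span_le.2 <|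
    Set.range_subset_iff.2 (initialSpeed_foldingUnfolding_mem h he hη)

theorem not_smoothGerms_le_extTangentSpaceAddSpeeds {φ : Euc 2 → Euc 3} (h : SmoothNear φ 0)
    (h0 : φ 0 = 0) {e : Euc 2} (he0 : e ≠ 0) (he : fderiv ℝ φ 0 e = 0) {η : Euc 3}
    (hη : ‖η‖ = 1) :
    ¬ smoothGerms 2 3 ≤
      extTangentSpaceAddSpeeds (foldingUnfolding φ η) (foldingMap φ η 0) := by
  intro hle
  -- The germ `⟨e, ·⟩ η`, on which the functional takes the value `‖e‖² ≠ 0`.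
  let L : Euc 2 →L[ℝ] Euc 3 := (innerSL ℝ e).smulRight η
  have hmem := (hle.trans (extTangentSpaceAddSpeeds_foldingUnfolding_le h h0 he hη))
    ⟨L, Filter.Eventually.of_forall fun _ => L.contDiff.contDiffAt, rfl⟩
  rw [ofFun_mem_germsWithDerivOrthogonal_iff L.differentiableAt, L.fderiv] at hmem
  simp [L, inner_smul_right, hη, he0] at hmem

/-! ### Failure of versality -/

/-- The one-parameter unfolding `f + v ⟨e, ·⟩ η` of `f`. -/
noncomputable def linearUnfolding (f : Euc 2 → Euc 3) (e : Euc 2) (η : Euc 3)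
    (z : Euc 2 × Euc 1) : Euc 3 × Euc 1 :=
  (f z.1 + (z.2 0 * inner ℝ e z.1) • η, z.2)

theorem isUnfolding_linearUnfolding {f : Euc 2 → Euc 3} (hf : SmoothNear f 0) (hf0 : f 0 = 0)
    (e : Euc 2) (η : Euc 3) : IsUnfolding (linearUnfolding f e η) f where
  smooth := by
    filter_upwards [(continuous_fst.tendsto (0 : Euc 2 × Euc 1)).eventually hf] with z hz
    have h1 : ContDiffAt ℝ ∞ (fun z : Euc 2 × Euc 1 => (inner ℝ e z.1 : ℝ)) z :=
      contDiffAt_const.inner ℝ contDiffAt_fst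
    have h2 : ContDiffAt ℝ ∞ (fun z : Euc 2 × Euc 1 => z.2 0) z := by fun_prop
    exact ((hz.comp z contDiffAt_fst).add ((h2.mul h1).smul contDiffAt_const)).prodMk
      contDiffAt_snd
  map_zero := by simp [linearUnfolding, hf0]
  snd_eq := Filter.Eventually.of_forall fun _ => rfl
  restrict := Filter.Eventually.of_forall fun x => by simp [linearUnfolding]

/-- Pair the inducing equation with `η` and differentiate at `z = 0` along `e`. The side induced
from the folding family contributes `0` for every `v`; the other side has `v`-derivative `‖e‖²` at
`v = 0`. -/
theorem not_isInducedFrom_foldingUnfolding {φ : Euc 2 → Euc 3} (h : SmoothNear φ 0)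
    (h0 : φ 0 = 0) {e : Euc 2} (he0 : e ≠ 0) (he : fderiv ℝ φ 0 e = 0) {η : Euc 3}
    (hη : ‖η‖ = 1) :
    ¬ IsInducedFrom (linearUnfolding (foldingMap φ η 0) e η) (foldingUnfolding φ η) := by
  rintro ⟨H, k, ψ, hH, hk, hψ, hH0, hk0, hψ0, heq⟩
  let ι : ℝ → Euc 1 := fun v => EuclideanSpace.single 0 v
  have hι : ContDiff ℝ ∞ ι := contDiff_euclidean.2 fun i => by
    fin_cases i; simpa [ι] using contDiff_fun_id
  have hι0 : ι 0 = 0 := by simp [ι]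
  -- The images of the origin and of the vector `e` under the source diffeomorphism at parameter
  -- `v`; they start at `0` and `e`.
  let c : ℝ → Euc 2 := fun v => H (0, ι v)
  let ε : ℝ → Euc 2 := fun v => fderiv ℝ (fun z => H (z, ι v)) 0 e
  have hpair : ContDiff ℝ ∞ fun v : ℝ => ((0 : Euc 2), ι v) := contDiff_const.prodMk hι
  have hpair0 : ((0 : Euc 2), ι 0) = 0 := by rw [hι0]; rfl
  have hc : ContDiffAt ℝ ∞ c 0 := by
    refine ContDiffAt.comp (g := H) 0 ?_ hpair.contDiffAt
    rw [hpair0]; exact hH.contDiffAt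
  have hε : DifferentiableAt ℝ ε 0 := by
    have : ContDiffAt ℝ ∞ (Function.uncurry fun (v : ℝ) (z : Euc 2) => H (z, ι v)) (0, 0) := by
      refine ContDiffAt.comp (g := H) (0, 0) ?_
        (contDiff_snd.prodMk (hι.comp contDiff_fst)).contDiffAt
      change ContDiffAt ℝ ∞ H (0, ι 0)
      rw [hpair0]; exact hH.contDiffAt
    exact ((this.fderiv (m := 1) contDiffAt_const (by norm_cast)).differentiableAt
      (by simp)).clm_apply (differentiableAt_const _)
  have hc0 : c 0 = 0 := by simpa [c, hι0] using hH0.self_of_nhds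
  have hε0 : ε 0 = e := by
    have : (fun z : Euc 2 => H (z, ι 0)) =ᶠ[𝓝 0] id := by rw [hι0]; exact hH0
    simp only [ε]
    rw [this.fderiv_eq, fderiv_id]; rfl
  have ht : Filter.Tendsto (fun v : ℝ => ((0 : Euc 2), ι v)) (𝓝 0) (𝓝 0) := by
    have := hpair.continuous.tendsto 0
    rwa [hpair0] at this
  have hct : Filter.Tendsto c (𝓝 0) (𝓝 0) := by
    have := hc.continuousAt.tendsto
    rwa [hc0] at this
  -- the equation, differentiated at `0` in the direction `e`
  have key : ∀ᶠ v : ℝ in 𝓝 0,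
      2 * inner ℝ η (φ (c v)) * inner ℝ η (fderiv ℝ φ (c v) (ε v)) + v * inner ℝ e (ε v)
        = (0 : ℝ) := by
    -- The point at which `k` is differentiated moves with `v`; it must stay where `k` is smooth.
    have hFt : Filter.Tendsto
        (fun v : ℝ => ((foldingUnfolding φ η ((0 : Euc 2), ψ (ι v))).1, ι v)) (𝓝 0) (𝓝 0) := by
      have hψι : ContinuousAt (fun v : ℝ => ((0 : Euc 2), ψ (ι v))) 0 := by
        refine continuousAt_const.prodMk
          (ContinuousAt.comp (g := ψ) ?_ hι.continuous.continuousAt)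
        rw [hι0]; exact hψ.contDiffAt.continuousAt
      have hF : ContinuousAt (fun v : ℝ => foldingUnfolding φ η ((0 : Euc 2), ψ (ι v))) 0 := by
        refine ContinuousAt.comp (g := foldingUnfolding φ η) ?_ hψι
        rw [hι0, hψ0]; exact (smoothNear_foldingUnfolding h hη).contDiffAt.continuousAt
      have := (hF.fst.prodMk hι.continuous.continuousAt).tendsto
      rw [hι0, hψ0, show ((0 : Euc 2), (0 : Euc 4)) = 0 from rfl,
        (isUnfolding_foldingUnfolding h h0 hη).map_zero] at this
      exact this
    filter_upwards [ht.eventually heq.eventually_nhds, ht.eventually hH, hct.eventually h,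
      hFt.eventually hk] with v hv hHv hφv hkv
    let g : Euc 2 → Euc 3 := foldingMap φ (perturbedNormal η (ψ (ι v))) (ψ (ι v) 3)
    have hslice : ContDiff ℝ ∞ fun z : Euc 2 => (z, ι v) := contDiff_id.prodMk contDiff_const
    have hg : HasFDerivAt g (fderiv ℝ g 0) 0 :=
      ((h.foldingMap _ _).contDiffAt.differentiableAt (by simp)).hasFDerivAt
    have hkg : HasFDerivAt (fun z => k (g z, ι v))
        ((fderiv ℝ k (g 0, ι v)).comp ((fderiv ℝ g 0).prod 0)) 0 :=
      HasFDerivAt.comp (g := k) 0 (hkv.differentiableAt (by simp)).hasFDerivAt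
        (hg.prodMk (hasFDerivAt_const (ι v) (0 : Euc 2)))
    have hHz : HasFDerivAt (fun z => H (z, ι v)) (fderiv ℝ (fun z => H (z, ι v)) 0) 0 :=
      ((ContDiffAt.comp (g := H) 0 hHv hslice.contDiffAt).differentiableAt
        (by simp)).hasFDerivAt
    have hφH : HasFDerivAt (fun z => φ (H (z, ι v)))
        ((fderiv ℝ φ (c v)).comp (fderiv ℝ (fun z => H (z, ι v)) 0)) 0 :=
      HasFDerivAt.comp (g := φ) 0 (hφv.differentiableAt (by simp)).hasFDerivAt hHz
    have hL := (((innerSL ℝ η).hasFDerivAt.comp 0 hφH).pow 2).add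
      (((innerSL ℝ e).hasFDerivAt.comp 0 hHz).const_mul v)
    have hR := (innerSL ℝ η).hasFDerivAt.comp 0 hkg
    have heqv : ∀ᶠ z : Euc 2 in 𝓝 0, (inner ℝ η (k (g z, ι v)) : ℝ) =
        (inner ℝ η (φ (H (z, ι v)))) ^ 2 + v * inner ℝ e (H (z, ι v)) := by
      filter_upwards [(hslice.continuous.tendsto 0).eventually hv] with z hz
      have hz' : foldingMap φ η 0 (H (z, ι v)) + (v * inner ℝ e (H (z, ι v))) • η =
          k (g z, ι v) := by
        simpa [linearUnfolding, foldingUnfolding, g, ι] using hz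
      rw [← hz', inner_add_right, inner_foldingMap_zero φ hη, inner_smul_right,
        real_inner_self_eq_norm_sq, hη]
      ring
    have := congrArg (fun L => L e) ((hL.congr_of_eventuallyEq heqv).unique hR)
    -- The right side drops out because `g` is again a folding map of `φ`, so `dg₀(e) = 0` whatever
    -- `ψ` is.
    simpa [g, fderiv_foldingMap_eq_zero h he, c, ε, ← Prod.zero_eq_mk] using this
  have hzero : HasDerivAt (fun v : ℝ => 2 * inner ℝ η (φ (c v)) *
      inner ℝ η (fderiv ℝ φ (c v) (ε v)) + v * inner ℝ e (ε v)) (0 : ℝ) 0 :=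
    (hasDerivAt_const (0 : ℝ) (0 : ℝ)).congr_of_eventuallyEq key
  have hφc : DifferentiableAt ℝ (fun v => φ (c v)) 0 := by
    refine DifferentiableAt.comp (g := φ) 0 ?_ (hc.differentiableAt (by simp))
    rw [hc0]; exact h.contDiffAt.differentiableAt (by simp)
  have hDφ : DifferentiableAt ℝ (fun v => fderiv ℝ φ (c v) (ε v)) 0 := by
    refine DifferentiableAt.clm_apply
      (DifferentiableAt.comp (g := fderiv ℝ φ) 0 ?_ (hc.differentiableAt (by simp))) hε
    rw [hc0]
    exact (h.contDiffAt.fderiv_right (m := 1) (by norm_cast)).differentiableAt (by simp)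
  have hA := ((innerSL ℝ η).hasFDerivAt (x := φ (c 0))).comp_hasDerivAt 0 hφc.hasDerivAt
  have hB := ((innerSL ℝ η).hasFDerivAt (x := fderiv ℝ φ (c 0) (ε 0))).comp_hasDerivAt 0
    hDφ.hasDerivAt
  have hC := ((innerSL ℝ e).hasFDerivAt (x := ε 0)).comp_hasDerivAt 0 hε.hasDerivAt
  -- At `v = 0` both factors `⟨η, φ(c)⟩` and `⟨η, dφ_c(ε)⟩` vanish, so their product has zero
  -- derivative. Only `⟨e, ε(0)⟩ = ‖e‖²` survives from the last term, contradicting `hzero`.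
  have hone := ((hA.const_mul 2).mul hB).add ((hasDerivAt_id (0 : ℝ)).mul hC)
  have := hzero.unique hone
  exact he0 (by simpa [hc0, hε0, h0, he] using this.symm)

theorem not_isAeVersal_foldingUnfolding {φ : Euc 2 → Euc 3} (h : SmoothNear φ 0)
    (h0 : φ 0 = 0) {e : Euc 2} (he0 : e ≠ 0) (he : fderiv ℝ φ 0 e = 0) {η : Euc 3}
    (hη : ‖η‖ = 1) : ¬ IsAeVersal (foldingUnfolding φ η) (foldingMap φ η 0) := fun hv =>
  not_isInducedFrom_foldingUnfolding h h0 he0 he hη <| hv.2 1 _ <|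
    isUnfolding_linearUnfolding (h.foldingMap η 0) (by simp [foldingMap, h0]) e η

/-! ### The cross-cap -/

section CrossCap

variable {a b : ℝ} {p : ℝ → ℝ} {q : Euc 2 → ℝ}

theorem smoothNear_crossCap (hp : SmoothNear p 0) (hq : SmoothNear q 0) :
    SmoothNear (crossCap a b p q) 0 := by
  have h1 : ∀ᶠ z : Euc 2 in 𝓝 0, ContDiffAt ℝ ∞ p (z 1) :=
    ((by fun_prop : Continuous fun z : Euc 2 => z 1).tendsto 0).eventually hp
  filter_upwards [h1, hq] with z hpz hqz
  have hp' : ContDiffAt ℝ ∞ (fun z : Euc 2 => p (z 1)) z :=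
    hpz.comp (f := fun z : Euc 2 => z 1) z (by fun_prop)
  refine contDiffAt_euclidean.2 fun i => ?_
  fin_cases i <;> simp [crossCap] <;> fun_prop

theorem crossCap_zero (hp3 : p =O[𝓝 0] fun y : ℝ => y ^ 3)
    (hq3 : q =O[𝓝 0] fun z : Euc 2 => ‖z‖ ^ 3) : crossCap a b p q 0 = 0 := by
  have h1 : p 0 = 0 := by simpa using hp3.eq_zero_imp.self_of_nhds
  have h2 : q 0 = 0 := by simpa using hq3.eq_zero_imp.self_of_nhds
  ext i; fin_cases i <;> simp [crossCap, h1, h2]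

/-- Along the `y`-axis the cross-cap is `(0, p(t), t² + q(0, t))`, which has no linear term. -/
theorem fderiv_crossCap_zero (hp : SmoothNear p 0) (hp3 : p =O[𝓝 0] fun y : ℝ => y ^ 3)
    (hq : SmoothNear q 0) (hq3 : q =O[𝓝 0] fun z : Euc 2 => ‖z‖ ^ 3) :
    fderiv ℝ (crossCap a b p q) 0 (EuclideanSpace.single 1 1) = 0 := by
  have hd : DifferentiableAt ℝ (crossCap a b p q) 0 :=
    (smoothNear_crossCap hp hq).contDiffAt.differentiableAt (by simp)
  have hl : HasDerivAt (fun t : ℝ => t • (EuclideanSpace.single 1 1 : Euc 2))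
      (EuclideanSpace.single 1 1) 0 := by
    simpa using (hasDerivAt_id (0 : ℝ)).smul_const (EuclideanSpace.single 1 1 : Euc 2)
  have hcomp : HasDerivAt (fun t : ℝ => crossCap a b p q (t • EuclideanSpace.single 1 1))
      (fderiv ℝ (crossCap a b p q) 0 (EuclideanSpace.single 1 1)) 0 := by
    refine HasFDerivAt.comp_hasDerivAt (l := crossCap a b p q) 0 ?_ hl
    simpa using hd.hasFDerivAt
  have hp' : HasDerivAt p 0 0 := by
    -- A function that is `O(‖y - 0‖ⁿ)` with `n > 1` has zero derivative at `0`; here `n = 3`.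
    have : p =O[𝓝 0] fun y => ‖y - 0‖ ^ 3 := by
      simpa only [sub_zero, norm_pow] using hp3.norm_right
    simpa using (this.hasFDerivAt (by norm_num)).hasDerivAt
  have hq' : HasDerivAt (fun t : ℝ => q (t • EuclideanSpace.single 1 1)) 0 0 := by
    have : q =O[𝓝 0] fun z => ‖z - 0‖ ^ 3 := by simpa only [sub_zero] using hq3
    have hq0 : HasFDerivAt q (0 : Euc 2 →L[ℝ] ℝ) ((0 : ℝ) • EuclideanSpace.single 1 1) := by
      simpa using this.hasFDerivAt (by norm_num)
    exact HasFDerivAt.comp_hasDerivAt (l := q) 0 hq0 hl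
  ext i
  refine ((EuclideanSpace.proj (𝕜 := ℝ) i).hasFDerivAt.comp_hasDerivAt 0 hcomp).unique ?_
  change HasDerivAt (fun t : ℝ => crossCap a b p q (t • EuclideanSpace.single 1 1) i) 0 0
  fin_cases i
  · simpa [crossCap] using hasDerivAt_const (0 : ℝ) (0 : ℝ)
  · simpa [crossCap] using hp'
  · have := ((hasDerivAt_id (0 : ℝ)).pow 2).fun_add hq'
    simpa [crossCap] using this

end CrossCap

/-- For a geometric cross-cap `φ` and every unit vector `η₀`, the four-parameter family of folding
maps near `(η₀, 0)` is an unfolding of `f_{η₀}` that is not `𝒜ₑ`-versal; moreover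
`Tₑ𝒜·f_{η₀} + ℝ·{Ḟ_u, Ḟ_v, Ḟ_w, Ḟ_δ}` does not contain all of `ℰ(2, 3)`. -/
theorem proposition3p3 (a b : ℝ) (p : ℝ → ℝ) (q : Euc 2 → ℝ)
    (hp : SmoothNear p 0) (hp3 : p =O[𝓝 0] fun y : ℝ => y ^ 3)
    (hq : SmoothNear q 0) (hq3 : q =O[𝓝 0] fun z : Euc 2 => ‖z‖ ^ 3)
    (η₀ : Euc 3) (hη₀ : ‖η₀‖ = 1) :
    IsUnfolding (foldingUnfolding (crossCap a b p q) η₀) (foldingMap (crossCap a b p q) η₀ 0) ∧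
    ¬ IsAeVersal (foldingUnfolding (crossCap a b p q) η₀)
        (foldingMap (crossCap a b p q) η₀ 0) ∧
    ¬ smoothGerms 2 3 ≤ extTangentSpaceAddSpeeds (foldingUnfolding (crossCap a b p q) η₀)
        (foldingMap (crossCap a b p q) η₀ 0) := by
  have h := smoothNear_crossCap (a := a) (b := b) hp hq
  have h0 := crossCap_zero (a := a) (b := b) hp3 hq3
  have he := fderiv_crossCap_zero (a := a) (b := b) hp hp3 hq hq3
  have he0 : (EuclideanSpace.single 1 1 : Euc 2) ≠ 0 := by simp
  exact ⟨isUnfolding_foldingUnfolding h h0 hη₀,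
    not_isAeVersal_foldingUnfolding h h0 he0 he hη₀,
    not_smoothGerms_le_extTangentSpaceAddSpeeds h h0 he0 he hη₀⟩
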